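/- Consider a retrial queue with capacity $K\ge 1$ (servers plus waiting room). Primary customers arrive according to a Poisson process with rate $\lambda>0$; when $i$ customers are in the system the total service rate is $\nu_i$, where $0=\nu_0\le\nu_1\le\dots\le\nu_K$ and $\nu_K>0$. A primary customer who finds $K$ customers in the system joins the orbit with probability $p\in(0,1]$ and is lost otherwise. Each customer in the orbit retries after an exponentially distributed time with rate $\mu>0$; it enters the system if there are fewer than $K$ customers there and returns to the orbit otherwise (every orbiting customer always retries and is never lost: the case $q=r=1$). Let $C(t)$ and $N(t)$ be the numbers of customers in the system and in the orbit. Then $X(t)=(C(t),N(t))$ is a continuous-time Markov chain on $\{0,\dots,K\}\times\mathbb Z_+$ with the following transition rates: $(i,n)\to(i+1,n)$ at rate $\lambda$ for $i<K$; $(i,n)\to(i-1,n)$ at rate $\nu_i$ for $i\ge1$; $(K,n)\to(K,n+1)$ at rate $\lambda p$; $(i,n)\to(i+1,n-1)$ at rate $n\mu$ for $i<K$, $n\ge1$. Assume that the chain is ergodic, so that the limits $$\pi_{i,n}=\lim_{t\to\infty}\Pr\{C(t)=i,\;N(t)=n\}$$ exist and form a probability distribution. Put $$\rho=\frac{\lambda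 p}{\nu_K},\qquad \alpha=\frac{\rho\,(\nu_K-p\,\nu_{K-1})}{p\,\mu}.$$ Then there exist constants $D_1,D_2>0$, independent of $n$, such that for all integers $n\ge 1$ $$D_1\,n^{\alpha}\rho^n\;\le\;\pi_{K,n}\;\le\;D_2\,n^{\alpha}\rho^n .$$ -/

import Mathlib

open MeasureTheory Filter Topology
open scoped NNReal

/-- Parameters of the Markovian retrial queue with room for `K` customers in the system:
primary arrival rate `lam`, orbit departure rate `mu` per retrial customer, total service rate
`nu i` when `i` customers are in the system (only `nu 0, …, nu K` matter), probability `p` that a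
blocked primary customer joins the orbit, probability `r` that a customer leaving the orbit
retries, and probability `q` that a blocked retrial customer goes back to the orbit. -/
structure RetrialQueue (K : ℕ) where
  lam : ℝ
  mu : ℝ
  p : ℝ
  q : ℝ
  r : ℝ
  nu : ℕ → ℝ
  lam_pos : 0 < lam
  mu_pos : 0 < mu
  p_nonneg : 0 ≤ p
  p_le_one : p ≤ 1
  q_nonneg : 0 ≤ q
  q_le_one : q ≤ 1
  r_nonneg : 0 ≤ r
  r_le_one : r ≤ 1
  nu_zero : nu 0 = 0
  nu_mono : ∀ i < K, nu i ≤ nu (i + 1)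

namespace RetrialQueue

/-- A state `(i, n)`: `i` customers in the system, `n` customers in the orbit. -/
abbrev State (K : ℕ) : Type := Fin (K + 1) × ℕ

variable {K : ℕ}

/-- Block of transitions from level `n` to level `n + 1` (the same for every `n`). -/
def blockUp (M : RetrialQueue K) : Matrix (Fin (K + 1)) (Fin (K + 1)) ℝ :=
  Matrix.of fun i j => if i = Fin.last K ∧ j = Fin.last K then M.lam * M.p else 0

/-- Diagonal entries of the block of transitions inside level `n`. -/
def diag (M : RetrialQueue K) (n : ℕ) (i : Fin (K + 1)) : ℝ :=
  if i = Fin.last K then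
    -(M.lam * M.p + n * M.mu * ((1 - M.r) + M.r * (1 - M.q)) + M.nu K)
  else -(M.lam + n * M.mu + M.nu i)

/-- Block of transitions inside level `n`. -/
def blockLocal (M : RetrialQueue K) (n : ℕ) : Matrix (Fin (K + 1)) (Fin (K + 1)) ℝ :=
  Matrix.of fun i j =>
    if j = i then M.diag n i
    else if (j : ℕ) = i + 1 then M.lam
    else if (i : ℕ) = j + 1 then M.nu i
    else 0

/-- Block of transitions from level `n` to level `n - 1`. -/
def blockDown (M : RetrialQueue K) (n : ℕ) : Matrix (Fin (K + 1)) (Fin (K + 1)) ℝ :=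
  Matrix.of fun i j =>
    if i = Fin.last K then
      if j = Fin.last K then n * M.mu * ((1 - M.r) + M.r * (1 - M.q)) else 0
    else if j = i then n * M.mu * (1 - M.r)
    else if (j : ℕ) = i + 1 then n * M.mu * M.r
    else 0

/-- The infinitesimal generator of the process (number in the system, number in the orbit). -/
def generator (M : RetrialQueue K) (x y : State K) : ℝ :=
  if y.2 = x.2 + 1 then M.blockUp x.1 y.1
  else if y.2 = x.2 then M.blockLocal x.2 x.1 y.1
  else if x.2 = y.2 + 1 then M.blockDown x.2 x.1 y.1
  else 0

/-- The load `ρ = λ p / ν_K`. -/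
noncomputable def rho (M : RetrialQueue K) : ℝ := M.lam * M.p / M.nu K

/-- The exponent `α = ρ (ν_K - p ν_{K-1}) / (p μ)`, meant for `1 ≤ K`. -/
noncomputable def alpha (M : RetrialQueue K) : ℝ :=
  M.rho * (M.nu K - M.p * M.nu (K - 1)) / (M.p * M.mu)

end RetrialQueue

/-- `p` is a (honest) transition function on the countable state space `S` whose matrix of
right derivatives at time `0` is `Q`. -/
structure IsTransitionFunction {S : Type*} [DecidableEq S] (Q : S → S → ℝ)
    (p : ℝ≥0 → S → S → ℝ) : Prop where
  nonneg : ∀ t x y, 0 ≤ p t x y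
  row_sum : ∀ t x, HasSum (fun y => p t x y) 1
  zero : ∀ x y, p 0 x y = if x = y then 1 else 0
  chapman_kolmogorov : ∀ s t x y, HasSum (fun z => p s x z * p t z y) (p (s + t) x y)
  deriv_zero : ∀ x y,
    Tendsto (fun t : ℝ≥0 => (p t x y - p 0 x y) / (t : ℝ)) (𝓝[>] 0) (𝓝 (Q x y))

/-- `X` is a time-homogeneous continuous-time Markov chain under `P` (with an arbitrary initial
law) with infinitesimal generator `Q`: the Markov property is with respect to the past
`σ(X u : u ≤ s)`. -/
def IsMarkovChainWithGenerator {Ω S : Type*} [MeasurableSpace Ω] [MeasurableSpace S]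
    [DecidableEq S] (P : Measure Ω) (X : ℝ≥0 → Ω → S) (Q : S → S → ℝ) : Prop :=
  (∀ t, Measurable (X t)) ∧
  ∃ p : ℝ≥0 → S → S → ℝ, IsTransitionFunction Q p ∧
    ∀ (s t : ℝ≥0) (x y : S) (A : Set Ω),
      MeasurableSet[⨆ u : Set.Iic s, MeasurableSpace.comap (X u) inferInstance] A →
      P.real (A ∩ {ω | X s ω = x} ∩ {ω | X (s + t) ω = y}) =
        P.real (A ∩ {ω | X s ω = x}) * p t x y

/-- `X` is ergodic under `P` with limiting probabilities `π`:
`π x = lim_{t → ∞} P (X t = x)` for every state, and `π` is a probability distribution. -/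
def HasLimitingDistribution {Ω S : Type*} [MeasurableSpace Ω] (P : Measure Ω)
    (X : ℝ≥0 → Ω → S) (π : S → ℝ) : Prop :=
  (∀ x, Tendsto (fun t => P.real {ω | X t ω = x}) atTop (𝓝 (π x))) ∧ HasSum π 1

/-! Write `a n` for `π_{K,n}`. Equating flows across the cut between orbit sizes `n` and `n + 1`,
and across the boundary of `{i ≤ m}` at orbit size `n`, gives two families of equations
(`IsCutBalanced`). They show that the mass of `{i < m}` at orbit size `n` is `O(n^{-(K-m+1)}) a n`:
each customer fewer in the system costs a factor `1/n` (`exists_sum_le`). Keeping two orders in the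
equation for the blocked states gives `a (n+1) (1 + c/(n+1)) = ρ a n (1 + d/(n+1)) + O(a (n+1) /
n²)`, with `d = λ/μ` and `c = ν_{K-1} ρ/μ` (`exists_ratio_bound`). Since `d - c = α`, summing
logarithms gives the order `n^α ρ^n`.

The limit law is first shown only to be subinvariant, which avoids exchanging an infinite sum with a
derivative. Equality in the cuts is then forced by monotonicity and `a n → 0`
(`IsCutBalanced.of_subinvariant`). -/

/-! ### Asymptotics of a sequence from its consecutive ratios. -/

theorem abs_log_one_add_sub_self_le {x : ℝ} (hx : |x| ≤ 1 / 2) :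
    |Real.log (1 + x) - x| ≤ 2 * x ^ 2 := by
  obtain ⟨h1, h2⟩ := abs_le.mp hx
  have hpos : 0 < 1 + x := by linarith
  have hup := Real.log_le_sub_one_of_pos hpos
  have hlo := Real.one_sub_inv_le_log_of_pos hpos
  have h3 : x - 2 * x ^ 2 ≤ 1 - (1 + x)⁻¹ := by
    have : 1 - (1 + x)⁻¹ - (x - 2 * x ^ 2) = x ^ 2 * (1 + 2 * x) / (1 + x) := by
      field_simp
      ring
    have h4 : 0 ≤ x ^ 2 * (1 + 2 * x) / (1 + x) :=
      div_nonneg (mul_nonneg (sq_nonneg x) (by linarith)) hpos.le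
    linarith
  rw [abs_le]
  constructor <;> nlinarith [sq_nonneg x]

/-- If `A (1 + c t) ≈ ρ B (1 + d t)` up to a relative error `E t²`, then
`log (A / B) = log ρ + (d - c) t + O(t²)`, where `t` is replaced by `-log (1 - t)`. -/
theorem abs_log_ratio_le {A B c d ρ E t : ℝ} (hA : 0 < A) (hB : 0 < B) (hρ : 0 < ρ) (hE : 0 ≤ E)
    (ht : 0 < t) (hsmall : (|c| + |d| + E + 1) * t ≤ 1 / 2)
    (h : |A * (1 + c * t) - ρ * B * (1 + d * t)| ≤ E * A * t ^ 2) :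
    |Real.log A - Real.log B - Real.log ρ + (d - c) * Real.log (1 + -t)| ≤
      (2 * d ^ 2 + (E + 2 * (|c| + E) ^ 2) + 2 * |d - c|) * t ^ 2 := by
  -- The error is absorbed into the factor of `A`, so that logarithms can be taken of an exact
  -- identity.
  obtain ⟨e, he, hae⟩ : ∃ e : ℝ, |e| ≤ E * t ^ 2 ∧ A * (1 + (c * t + e)) = ρ * B * (1 + d * t) := by
    refine ⟨-(A * (1 + c * t) - ρ * B * (1 + d * t)) / A, ?_, ?_⟩
    · rw [abs_div, abs_neg, abs_of_pos hA, div_le_iff₀ hA]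
      linarith
    · have := mul_div_cancel₀ (-(A * (1 + c * t) - ρ * B * (1 + d * t))) hA.ne'
      linear_combination this
  have hct := mul_nonneg (abs_nonneg c) ht.le
  have hdt := mul_nonneg (abs_nonneg d) ht.le
  have hEt := mul_nonneg hE ht.le
  have hsplit : |c| * t + |d| * t + E * t + t ≤ 1 / 2 := by linarith
  have hEt2 : E * t ^ 2 ≤ E * t := by
    have := mul_le_mul_of_nonneg_left (show t ≤ 1 by linarith) hEt
    linarith
  have hct' : |c * t| = |c| * t := by rw [abs_mul, abs_of_pos ht]
  have hdt' : |d * t| = |d| * t := by rw [abs_mul, abs_of_pos ht]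
  have habs : |c * t + e| ≤ (|c| + E) * t := by
    have := abs_add_le (c * t) e
    linarith
  have hx : |d * t| ≤ 1 / 2 := by linarith
  have hy : |c * t + e| ≤ 1 / 2 := by linarith
  have hz : |-t| ≤ 1 / 2 := by rw [abs_neg, abs_of_pos ht]; linarith
  have l1 := abs_log_one_add_sub_self_le hx
  have l2 := abs_log_one_add_sub_self_le hy
  have l3 := abs_log_one_add_sub_self_le hz
  have hp1 : 0 < 1 + d * t := by have := (abs_le.mp hx).1; linarith
  have hp2 : 0 < 1 + (c * t + e) := by have := (abs_le.mp hy).1; linarith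
  have hlog : Real.log A + Real.log (1 + (c * t + e)) =
      Real.log ρ + Real.log B + Real.log (1 + d * t) := by
    rw [← Real.log_mul hA.ne' hp2.ne', hae, Real.log_mul (mul_pos hρ hB).ne' hp1.ne',
      Real.log_mul hρ.ne' hB.ne']
  have hdiff : Real.log A - Real.log B - Real.log ρ + (d - c) * Real.log (1 + -t) =
      (Real.log (1 + d * t) - d * t) - ((Real.log (1 + (c * t + e)) - (c * t + e)) + e)
      + (d - c) * (Real.log (1 + -t) - -t) := by
    linear_combination hlog
  have hsq : (c * t + e) ^ 2 ≤ (|c| + E) ^ 2 * t ^ 2 := by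
    rw [← mul_pow, ← sq_abs (c * t + e)]
    exact pow_le_pow_left₀ (abs_nonneg _) habs 2
  have t1 := abs_add_le ((Real.log (1 + d * t) - d * t)
    - ((Real.log (1 + (c * t + e)) - (c * t + e)) + e)) ((d - c) * (Real.log (1 + -t) - -t))
  have t2 := abs_sub (Real.log (1 + d * t) - d * t)
    ((Real.log (1 + (c * t + e)) - (c * t + e)) + e)
  have t3 := abs_add_le (Real.log (1 + (c * t + e)) - (c * t + e)) e
  have t4 := mul_le_mul_of_nonneg_left l3 (abs_nonneg (d - c))
  rw [abs_mul (d - c)] at t1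
  rw [hdiff]
  have hring : (2 * d ^ 2 + (E + 2 * (|c| + E) ^ 2) + 2 * |d - c|) * t ^ 2 =
      2 * (d * t) ^ 2 + (2 * ((|c| + E) ^ 2 * t ^ 2) + E * t ^ 2)
        + |d - c| * (2 * (-t) ^ 2) := by ring
  rw [hring]
  linarith

/-- A positive sequence whose consecutive ratios are `ρ (1 + (d - c) / n + O(n⁻²))` has the exact
order `n ^ (d - c) ρ ^ n`. -/
theorem exists_rpow_mul_pow_bounds {a : ℕ → ℝ} {c d ρ E : ℝ} (ha : ∀ n, 0 < a n) (hρ : 0 < ρ)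
    (hE : 0 ≤ E)
    (h : ∀ n : ℕ, |a (n + 1) * (1 + c / (n + 1 : ℕ)) - ρ * a n * (1 + d / (n + 1 : ℕ))|
      ≤ E * a (n + 1) / ((n + 1 : ℕ) : ℝ) ^ 2) :
    ∃ D₁ D₂ : ℝ, 0 < D₁ ∧ 0 < D₂ ∧ ∀ n : ℕ, 1 ≤ n →
      D₁ * (n : ℝ) ^ (d - c) * ρ ^ n ≤ a n ∧ a n ≤ D₂ * (n : ℝ) ^ (d - c) * ρ ^ n := by
  -- `v` is the logarithm of `a n / (n ^ (d - c) * ρ ^ n)` for `n ≥ 1`. Its increments are `O(n⁻²)`,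
  -- so it is Cauchy and hence bounded.
  set v : ℕ → ℝ := fun n => Real.log (a n) - n * Real.log ρ - (d - c) * Real.log n with hv
  set B : ℝ := 2 * d ^ 2 + (E + 2 * (|c| + E) ^ 2) + 2 * |d - c| with hB
  have step : ∀ᶠ n : ℕ in atTop, |v (n + 1) - v n| ≤ B * (1 / ((n + 1 : ℕ) : ℝ) ^ 2) := by
    obtain ⟨N₀, hN₀⟩ := exists_nat_ge (2 * (|c| + |d| + E + 1))
    filter_upwards [eventually_ge_atTop (N₀ + 1)] with n hn
    have hn0 : (0 : ℝ) < n := by exact_mod_cast (by omega : 0 < n)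
    have hnN : (N₀ : ℝ) ≤ n := by exact_mod_cast (by omega : N₀ ≤ n)
    have hN0 : (0 : ℝ) < ((n + 1 : ℕ) : ℝ) := by positivity
    have hsmall : (|c| + |d| + E + 1) * (1 / ((n + 1 : ℕ) : ℝ)) ≤ 1 / 2 := by
      rw [mul_one_div, div_le_iff₀ hN0]; push_cast; linarith
    -- With `t = 1 / (n + 1)`, `-log (1 - t)` is exactly the increment of `log n`, so the
    -- first-order term telescopes.
    have hlogn : Real.log n = Real.log (n + 1 : ℕ) + Real.log (1 + -(1 / ((n + 1 : ℕ) : ℝ))) := by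
      have h1t : 1 + -(1 / ((n + 1 : ℕ) : ℝ)) = n / (n + 1 : ℕ) := by
        push_cast; field_simp; ring
      rw [h1t, Real.log_div hn0.ne' hN0.ne']; ring
    have key := abs_log_ratio_le (c := c) (d := d) (ha (n + 1)) (ha n) hρ hE
      (one_div_pos.mpr hN0) hsmall (by
        rw [mul_one_div, mul_one_div, div_pow, one_pow, mul_one_div]
        exact h n)
    rw [div_pow, one_pow] at key
    refine (le_of_eq ?_).trans key
    congr 1
    simp only [hv]
    rw [hlogn]
    push_cast
    ring
  have hsum : Summable fun n : ℕ => dist (v n) (v (n + 1)) := by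
    have hs : Summable fun n : ℕ => B * (1 / ((n + 1 : ℕ) : ℝ) ^ 2) :=
      ((summable_nat_add_iff 1).mpr (Real.summable_one_div_nat_pow.mpr one_lt_two)).mul_left B
    refine Summable.of_norm_bounded_eventually_nat hs ?_
    filter_upwards [step] with n hn
    rwa [Real.norm_eq_abs, abs_of_nonneg dist_nonneg, dist_comm, Real.dist_eq]
  obtain ⟨R, hR⟩ := (Metric.isBounded_iff_subset_closedBall (0 : ℝ)).mp
    (cauchySeq_of_summable_dist hsum).isBounded_range
  have hvR : ∀ n, |v n| ≤ R := fun n => by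
    simpa [Real.dist_eq] using hR (Set.mem_range_self n)
  refine ⟨Real.exp (-R), Real.exp R, Real.exp_pos _, Real.exp_pos _, fun n hn => ?_⟩
  have hn0 : (0 : ℝ) < n := by exact_mod_cast hn
  have hform : ∀ r : ℝ, Real.exp r * (n : ℝ) ^ (d - c) * ρ ^ n =
      Real.exp (r + (d - c) * Real.log n + n * Real.log ρ) := by
    intro r
    rw [Real.exp_add, Real.exp_add, Real.rpow_def_of_pos hn0, Real.exp_nat_mul, Real.exp_log hρ,
      mul_comm (Real.log n)]
  have hb := abs_le.mp (hvR n)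
  simp only [hv] at hb
  rw [hform, hform, ← Real.le_log_iff_exp_le (ha n), ← Real.log_le_iff_le_exp (ha n)]
  constructor <;> linarith

/-! ### Consequences of the cut equations. -/

/-- Cut equations of a stationary measure `f` of the retrial queue with room for `k + 1` customers:
`f i n` is the mass of the state with `i` customers in the system and `n` in the orbit. -/
structure IsCutBalanced (k : ℕ) (lam mu p : ℝ) (nu : ℕ → ℝ) (f : ℕ → ℕ → ℝ) : Prop where
  lam_pos : 0 < lam
  mu_pos : 0 < mu
  p_pos : 0 < p
  nu_zero : nu 0 = 0
  nu_nonneg : ∀ i ≤ k + 1, 0 ≤ nu i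
  nu_last_pos : 0 < nu (k + 1)
  nonneg : ∀ i n, 0 ≤ f i n
  cut_orbit : ∀ n : ℕ, lam * p * f (k + 1) n =
    (n + 1) * mu * ∑ i ∈ Finset.range (k + 1), f i (n + 1)
  cut_level : ∀ m ≤ k, ∀ n : ℕ, n * mu * ∑ i ∈ Finset.range (m + 1), f i n + lam * f m n =
    nu (m + 1) * f (m + 1) n + (n + 1) * mu * ∑ i ∈ Finset.range m, f i (n + 1)

namespace IsCutBalanced

variable {k : ℕ} {lam mu p : ℝ} {nu : ℕ → ℝ} {f : ℕ → ℕ → ℝ}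

theorem sum_nonneg (h : IsCutBalanced k lam mu p nu f) (m n : ℕ) :
    0 ≤ ∑ i ∈ Finset.range m, f i n :=
  Finset.sum_nonneg fun i _ => h.nonneg i n

theorem le_sum (h : IsCutBalanced k lam mu p nu f) {i m : ℕ} (hi : i < m) (n : ℕ) :
    f i n ≤ ∑ i ∈ Finset.range m, f i n :=
  Finset.single_le_sum (f := fun i => f i n) (fun j _ => h.nonneg j n) (Finset.mem_range.mpr hi)

theorem sum_mono (h : IsCutBalanced k lam mu p nu f) {l m : ℕ} (hl : l ≤ m) (n : ℕ) :
    ∑ i ∈ Finset.range l, f i n ≤ ∑ i ∈ Finset.range m, f i n :=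
  Finset.sum_le_sum_of_subset_of_nonneg (Finset.range_mono hl) fun i _ _ => h.nonneg i n

theorem nu_last_mul (h : IsCutBalanced k lam mu p nu f) (n : ℕ) :
    nu (k + 1) * f (k + 1) (n + 1) = lam * p * f (k + 1) n + lam * f k (n + 1)
      - (n + 2) * mu * ∑ i ∈ Finset.range k, f i (n + 2) := by
  have h1 := h.cut_level k le_rfl (n + 1)
  have h2 := h.cut_orbit n
  push_cast at h1
  rw [show ((n : ℝ) + 1 + 1) = n + 2 by ring] at h1
  linear_combination -h1 - h2

/-- The subtracted flow in `nu_last_mul` is at most the whole orbit flow, which is `lam * p * f (k +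
1) (n + 1)`. -/
theorem le_mul_succ (h : IsCutBalanced k lam mu p nu f) (n : ℕ) :
    lam * p * f (k + 1) n ≤ (nu (k + 1) + lam * p) * f (k + 1) (n + 1) := by
  have h1 := h.nu_last_mul n
  have h2 := h.cut_orbit (n + 1)
  have h3 := mul_le_mul_of_nonneg_left (h.sum_mono k.le_succ (n + 2))
    (show 0 ≤ ((n : ℝ) + 2) * mu by have := h.mu_pos; positivity)
  have h4 := mul_nonneg h.lam_pos.le (h.nonneg k (n + 1))
  push_cast at h2
  rw [show ((n : ℝ) + 1 + 1) = n + 2 by ring] at h2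
  simp only [Nat.succ_eq_add_one] at h3
  linarith

theorem succ_le_mul (h : IsCutBalanced k lam mu p nu f) (n : ℕ) :
    nu (k + 1) * f (k + 1) (n + 1) ≤ (lam * p + lam * (lam * p / mu)) * f (k + 1) n := by
  have hmu := h.mu_pos
  have h1 := h.nu_last_mul n
  have h2 := h.cut_orbit n
  have h3 : 0 ≤ ((n : ℝ) + 2) * mu * ∑ i ∈ Finset.range k, f i (n + 2) :=
    mul_nonneg (by positivity) (h.sum_nonneg _ _)
  have h4 : f k (n + 1) ≤ lam * p / mu * f (k + 1) n := by
    rw [div_mul_eq_mul_div, h2, le_div_iff₀ hmu]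
    have h5 := h.le_sum k.lt_succ_self (n + 1)
    have h6 := h.sum_nonneg (k + 1) (n + 1)
    have h7 : 0 ≤ (n : ℝ) * mu * ∑ i ∈ Finset.range (k + 1), f i (n + 1) := by positivity
    simp only [Nat.succ_eq_add_one] at h5
    nlinarith
  have h5 := mul_le_mul_of_nonneg_left h4 h.lam_pos.le
  linarith

/-- Positivity propagates upwards in `n` by `le_mul_succ`. A zero at `n = 0` would propagate by
`succ_le_mul` to all blocked states, then by the orbit cuts to all `n ≥ 1`, and finally down through
the level cuts at `n = 0`. -/
theorem last_pos (h : IsCutBalanced k lam mu p nu f) (hne : ∃ i ≤ k + 1, ∃ n, f i n ≠ 0) (n : ℕ) :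
    0 < f (k + 1) n := by
  have hlp := mul_pos h.lam_pos h.p_pos
  induction n with
  | succ n ih =>
    have h1 := h.le_mul_succ n
    have h2 := h.nu_last_pos
    have h3 : 0 < (nu (k + 1) + lam * p) * f (k + 1) (n + 1) := (mul_pos hlp ih).trans_le h1
    exact pos_of_mul_pos_right h3 (by linarith)
  | zero =>
    refine (h.nonneg _ _).lt_of_ne' fun h0 => ?_
    have hlast : ∀ n, f (k + 1) n = 0 := by
      intro n
      induction n with
      | zero => exact h0
      | succ n ih =>
        have h1 := h.succ_le_mul n
        rw [ih, mul_zero] at h1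
        exact le_antisymm (nonpos_of_mul_nonpos_right h1 h.nu_last_pos) (h.nonneg _ _)
    have hS : ∀ n, ∑ i ∈ Finset.range (k + 1), f i (n + 1) = 0 := by
      intro n
      have h1 := h.cut_orbit n
      rw [hlast, mul_zero] at h1
      have h2 : ((n : ℝ) + 1) * mu ≠ 0 := by have := h.mu_pos; positivity
      exact (mul_eq_zero.mp h1.symm).resolve_left h2
    have hsucc : ∀ i ≤ k, ∀ n, f i (n + 1) = 0 := fun i hi n =>
      le_antisymm ((h.le_sum (Nat.lt_succ_of_le hi) (n + 1)).trans_eq (hS n)) (h.nonneg _ _)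
    have hzero : ∀ j ≤ k + 1, f (k + 1 - j) 0 = 0 := by
      intro j
      induction j with
      | zero => intro _; simpa using h0
      | succ j ih =>
        intro hj
        have h1 := h.cut_level (k + 1 - (j + 1)) (by omega) 0
        rw [show k + 1 - (j + 1) + 1 = k + 1 - j by omega, ih (by omega)] at h1
        rw [Finset.sum_eq_zero (s := Finset.range (k + 1 - (j + 1)))
          (fun i hi => hsucc i (by have := Finset.mem_range.mp hi; omega) 0)] at h1
        have h2 : lam * f (k + 1 - (j + 1)) 0 = 0 := by simpa using h1
        exact (mul_eq_zero.mp h2).resolve_left h.lam_pos.ne'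
    obtain ⟨i, hi, n, hin⟩ := hne
    apply hin
    rcases n with _ | n
    · have := hzero (k + 1 - i) (by omega)
      rwa [show k + 1 - (k + 1 - i) = i by omega] at this
    · rcases hi.lt_or_eq with hi | rfl
      · exact hsucc i (by omega) n
      · exact hlast _

theorem exists_succ_le (h : IsCutBalanced k lam mu p nu f) :
    ∃ C : ℝ, 0 ≤ C ∧ ∀ n, f (k + 1) (n + 1) ≤ C * f (k + 1) n := by
  have := h.nu_last_pos
  have := h.lam_pos
  have := h.mu_pos
  have := h.p_pos
  refine ⟨(lam * p + lam * (lam * p / mu)) / nu (k + 1), by positivity, fun n => ?_⟩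
  rw [div_mul_eq_mul_div, le_div_iff₀ h.nu_last_pos, mul_comm]
  exact h.succ_le_mul n

/-- The level cut at `m` bounds `n * mu` times the mass of `{i ≤ m}` by the service flow out of `m +
1` plus an inflow from orbit size `n + 1`. The first is controlled by `h1`, the second by `h2`,
whose extra power pays for the factor `n + 1`. -/
theorem pow_mul_sum_le_succ (h : IsCutBalanced k lam mu p nu f) {j m : ℕ} (hm : m + 1 ≤ k)
    (h1 : ∃ C : ℝ, 0 ≤ C ∧ ∀ n : ℕ, 1 ≤ n →
      (n : ℝ) ^ j * ∑ i ∈ Finset.range (m + 2), f i n ≤ C * f (k + 1) n)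
    (h2 : ∃ C : ℝ, 0 ≤ C ∧ ∀ n : ℕ, 1 ≤ n →
      (n : ℝ) ^ (j + 1) * ∑ i ∈ Finset.range m, f i n ≤ C * f (k + 1) n) :
    ∃ C : ℝ, 0 ≤ C ∧ ∀ n : ℕ, 1 ≤ n →
      (n : ℝ) ^ (j + 1) * ∑ i ∈ Finset.range (m + 1), f i n ≤ C * f (k + 1) n := by
  obtain ⟨C₁, hC₁, h1⟩ := h1
  obtain ⟨C₂, hC₂, h2⟩ := h2
  obtain ⟨R, hR0, hR⟩ := h.exists_succ_le
  have hmu := h.mu_pos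
  have hnu := h.nu_nonneg (m + 1) (by omega)
  refine ⟨(nu (m + 1) * C₁ + mu * (C₂ * R)) / mu, by positivity, fun n hn => ?_⟩
  have e1 : f (m + 1) n ≤ ∑ i ∈ Finset.range (m + 2), f i n := h.le_sum (by omega) n
  have e2 : (n : ℝ) ^ j * f (m + 1) n ≤ C₁ * f (k + 1) n :=
    (mul_le_mul_of_nonneg_left e1 (by positivity)).trans (h1 n hn)
  have e3 : (n : ℝ) ^ j * ((n + 1) * ∑ i ∈ Finset.range m, f i (n + 1))
      ≤ C₂ * R * f (k + 1) n := by
    have hs := h.sum_nonneg m (n + 1)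
    calc (n : ℝ) ^ j * ((n + 1) * ∑ i ∈ Finset.range m, f i (n + 1))
        ≤ ((n : ℝ) + 1) ^ j * ((n + 1) * ∑ i ∈ Finset.range m, f i (n + 1)) := by
          gcongr; linarith
      _ = ((n + 1 : ℕ) : ℝ) ^ (j + 1) * ∑ i ∈ Finset.range m, f i (n + 1) := by
          push_cast; ring
      _ ≤ C₂ * f (k + 1) (n + 1) := h2 (n + 1) (by omega)
      _ ≤ C₂ * (R * f (k + 1) n) := mul_le_mul_of_nonneg_left (hR n) hC₂
      _ = _ := by ring
  have e4 := h.cut_level m (by omega) n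
  have e5 : 0 ≤ (n : ℝ) ^ j * (lam * f m n) :=
    mul_nonneg (by positivity) (mul_nonneg h.lam_pos.le (h.nonneg _ _))
  rw [div_mul_eq_mul_div, le_div_iff₀ hmu]
  have e6 : (n : ℝ) ^ (j + 1) * (∑ i ∈ Finset.range (m + 1), f i n) * mu
      = nu (m + 1) * ((n : ℝ) ^ j * f (m + 1) n)
        + mu * ((n : ℝ) ^ j * ((n + 1) * ∑ i ∈ Finset.range m, f i (n + 1)))
        - (n : ℝ) ^ j * (lam * f m n) := by
    rw [pow_succ]
    linear_combination (n : ℝ) ^ j * e4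
  have e7 := mul_le_mul_of_nonneg_left e2 hnu
  have e8 := mul_le_mul_of_nonneg_left e3 hmu.le
  linarith

theorem exists_sum_le (h : IsCutBalanced k lam mu p nu f) (j m : ℕ) (hjm : m + j ≤ k + 1) :
    ∃ C : ℝ, 0 ≤ C ∧ ∀ n : ℕ, 1 ≤ n →
      (n : ℝ) ^ (j + 1) * ∑ i ∈ Finset.range m, f i n ≤ C * f (k + 1) n := by
  induction j generalizing m with
  | zero =>
    have hlp := mul_pos h.lam_pos h.p_pos
    have := h.nu_last_pos
    have hmu := h.mu_pos
    refine ⟨(nu (k + 1) + lam * p) / mu, by positivity, fun n hn => ?_⟩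
    obtain ⟨n, rfl⟩ := Nat.exists_eq_add_of_le' hn
    have h1 := h.cut_orbit n
    have h2 := h.le_mul_succ n
    have h3 := mul_le_mul_of_nonneg_left (h.sum_mono (show m ≤ k + 1 by omega) (n + 1))
      (show 0 ≤ ((n : ℝ) + 1) * mu by positivity)
    rw [div_mul_eq_mul_div, le_div_iff₀ hmu]
    push_cast
    rw [pow_one]
    linarith
  | succ j ih =>
    induction m with
    | zero => exact ⟨0, le_rfl, fun n _ => by simp⟩
    | succ m ihm =>
      -- One power less allows one customer more, so `m + 2` is still admissible for `ih`.
      exact h.pow_mul_sum_le_succ (by omega) (ih (m + 2) (by omega)) (ihm (by omega))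

/-- The flow from the orbit into the system out of the states with fewer than `k` customers in the
system, up to second order. -/
theorem exists_orbit_flow_bound (h : IsCutBalanced k lam mu p nu f) :
    ∃ C : ℝ, 0 ≤ C ∧ ∀ n : ℕ, 1 ≤ n →
      |(n + 1) * mu * ∑ i ∈ Finset.range k, f i (n + 1)
        - nu k * (lam * p / mu) * f (k + 1) n / n| ≤ C * f (k + 1) n / (n : ℝ) ^ 2 := by
  rcases k with _ | l
  · exact ⟨0, le_rfl, fun n _ => by simp [h.nu_zero]⟩
  obtain ⟨C₂, hC₂, h2⟩ := h.exists_sum_le 1 (l + 1) (by omega)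
  obtain ⟨C₃, hC₃, h3⟩ := h.exists_sum_le 2 l (by omega)
  obtain ⟨R, hR0, hR⟩ := h.exists_succ_le
  have hmu := h.mu_pos
  have hlam := h.lam_pos
  have hp := h.p_pos
  have hnu := h.nu_nonneg (l + 1) (by omega)
  -- The four terms bound `nu (l + 1) * T`, the arrivals from `l`, the retrial inflow through `U`,
  -- and the replacement of `1 / (n + 1)` by `1 / n`.
  refine ⟨nu (l + 1) * (C₂ * R) + lam * (C₂ * R) + mu * (C₃ * R * R)
    + nu (l + 1) * (lam * p / mu), by positivity, fun n hn => ?_⟩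
  have hn0 : (0 : ℝ) < n := by exact_mod_cast hn
  set a := f (l + 1 + 1) n with ha
  have ha0 : 0 ≤ a := h.nonneg _ _
  set T := ∑ i ∈ Finset.range (l + 1), f i (n + 1) with hT
  set U := ∑ i ∈ Finset.range l, f i (n + 2) with hU
  have hT0 : 0 ≤ T := h.sum_nonneg _ _
  have hU0 : 0 ≤ U := h.sum_nonneg _ _
  have hfl0 : 0 ≤ f l (n + 1) := h.nonneg _ _
  have hfl : f l (n + 1) ≤ T := h.le_sum (by omega) _
  have bT : (n : ℝ) ^ 2 * T ≤ C₂ * R * a := by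
    have e := h2 (n + 1) (by omega)
    have e' := mul_le_mul_of_nonneg_left (hR n) hC₂
    have : (n : ℝ) ^ 2 * T ≤ ((n + 1 : ℕ) : ℝ) ^ 2 * T := by
      push_cast; gcongr; linarith
    have e'' : ((n + 1 : ℕ) : ℝ) ^ 2 * T ≤ C₂ * f (l + 1 + 1) (n + 1) := e
    linarith
  have bU : (n : ℝ) ^ 2 * ((n + 2) * U) ≤ C₃ * R * R * a := by
    have e : ((n + 2 : ℕ) : ℝ) ^ 3 * U ≤ C₃ * f (l + 1 + 1) (n + 2) := h3 (n + 2) (by omega)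
    have e1 := mul_le_mul_of_nonneg_left (hR (n + 1)) hC₃
    have e2 := mul_le_mul_of_nonneg_left (hR n) (mul_nonneg hC₃ hR0)
    have : (n : ℝ) ^ 2 * ((n + 2) * U) ≤ ((n + 2 : ℕ) : ℝ) ^ 3 * U := by
      push_cast
      rw [show ((n : ℝ) + 2) ^ 3 * U = (n + 2) ^ 2 * ((n + 2) * U) by ring]
      gcongr; linarith
    linarith
  have hlev := h.cut_level l (by omega) (n + 1)
  have hcut := h.cut_orbit n
  rw [Finset.sum_range_succ] at hcut
  push_cast at hlev
  rw [show ((n : ℝ) + 1 + 1) = n + 2 by ring, ← hT, ← hU] at hlev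
  rw [← hT, ← ha] at hcut
  have hfk : f (l + 1) (n + 1) = lam * p / mu * a / (n + 1) - T := by
    field_simp
    linear_combination -hcut
  rw [hfk] at hlev
  have hmain : ((n : ℝ) + 1) * mu * T - nu (l + 1) * (lam * p / mu) * a / n
      = mu * ((n + 2) * U) - nu (l + 1) * T - lam * f l (n + 1)
        - nu (l + 1) * (lam * p / mu) * (a / (n * (n + 1))) := by
    have e : a / (n : ℝ) = a / (n + 1) + a / (n * (n + 1)) := by field_simp
    have e' : nu (l + 1) * (lam * p / mu) * a / n = nu (l + 1) * (lam * p / mu) * (a / n) := by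
      ring
    rw [e', e]
    linear_combination hlev
  have hn2 : (0 : ℝ) < (n : ℝ) ^ 2 := by positivity
  have q1 : T ≤ C₂ * R * a / (n : ℝ) ^ 2 := by rw [le_div_iff₀ hn2]; linarith
  have q2 : ((n : ℝ) + 2) * U ≤ C₃ * R * R * a / (n : ℝ) ^ 2 := by rw [le_div_iff₀ hn2]; linarith
  have q3 : a / (n * ((n : ℝ) + 1)) ≤ a / (n : ℝ) ^ 2 := by
    apply div_le_div_of_nonneg_left ha0 hn2; nlinarith
  have q30 : 0 ≤ a / (n * ((n : ℝ) + 1)) := by positivity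
  have r1 := mul_le_mul_of_nonneg_left q1 hnu
  have r2 := mul_le_mul_of_nonneg_left q2 hmu.le
  have hkappa : 0 ≤ nu (l + 1) * (lam * p / mu) := by positivity
  have r3 := mul_le_mul_of_nonneg_left q3 hkappa
  have r4 := mul_le_mul_of_nonneg_left (hfl.trans q1) hlam.le
  have s1 := mul_nonneg hnu hT0
  have s2 : 0 ≤ mu * (((n : ℝ) + 2) * U) := by positivity
  have s3 := mul_nonneg hkappa q30
  have s4 := mul_nonneg hlam.le hfl0
  have htot : (nu (l + 1) * (C₂ * R) + lam * (C₂ * R) + mu * (C₃ * R * R)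
      + nu (l + 1) * (lam * p / mu)) * a / (n : ℝ) ^ 2
      = nu (l + 1) * (C₂ * R * a / (n : ℝ) ^ 2) + lam * (C₂ * R * a / (n : ℝ) ^ 2)
        + mu * (C₃ * R * R * a / (n : ℝ) ^ 2)
        + nu (l + 1) * (lam * p / mu) * (a / (n : ℝ) ^ 2) := by ring
  rw [hmain, htot, abs_le]
  constructor <;> linarith

/-- The ratio of consecutive masses of the blocked states, up to second order. -/
theorem exists_ratio_bound (h : IsCutBalanced k lam mu p nu f) :
    ∃ E : ℝ, 0 ≤ E ∧ ∀ n : ℕ,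
      |f (k + 1) (n + 1) * (1 + nu k * (lam * p / nu (k + 1)) / mu / (n + 1 : ℕ))
        - lam * p / nu (k + 1) * f (k + 1) n * (1 + lam / mu / (n + 1 : ℕ))|
      ≤ E * f (k + 1) (n + 1) / ((n + 1 : ℕ) : ℝ) ^ 2 := by
  obtain ⟨C₁, hC₁, h1⟩ := h.exists_orbit_flow_bound
  obtain ⟨C₂, hC₂, h2⟩ := h.exists_sum_le 1 k (by omega)
  have hmu := h.mu_pos
  have hlam := h.lam_pos
  have hp := h.p_pos
  have hnu := h.nu_last_pos
  refine ⟨(C₁ + lam * C₂) / nu (k + 1), by positivity, fun n => ?_⟩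
  have b1 := h1 (n + 1) (by omega)
  have b2 := h2 (n + 1) (by omega)
  have hcut := h.cut_orbit n
  have hlast := h.nu_last_mul n
  rw [Finset.sum_range_succ] at hcut
  have hN : ((n : ℝ) + 1) = ((n + 1 : ℕ) : ℝ) := by push_cast; ring
  rw [show ((n : ℝ) + 2) = ((n + 1 : ℕ) : ℝ) + 1 by push_cast; ring] at hlast
  rw [hN] at hcut
  have hN0 : (0 : ℝ) < ((n + 1 : ℕ) : ℝ) := by positivity
  set N : ℝ := ((n + 1 : ℕ) : ℝ)
  set a := f (k + 1) (n + 1)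
  set b := f (k + 1) n
  have hT0 : 0 ≤ ∑ i ∈ Finset.range k, f i (n + 1) := h.sum_nonneg _ _
  set T := ∑ i ∈ Finset.range k, f i (n + 1)
  set V := (N + 1) * mu * ∑ i ∈ Finset.range k, f i (n + 2)
  have hV : |V - nu k * (lam * p / mu) * a / N| ≤ C₁ * a / N ^ 2 := b1
  have hTb : T ≤ C₂ * a / N ^ 2 := by
    rw [le_div_iff₀ (by positivity)]
    have : N ^ 2 * T ≤ C₂ * a := b2
    linarith
  -- By the orbit cut, nearly all retrials that enter find `k` customers. This term produces `d`,
  -- while `V` produces `c`.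
  have hfk : f k (n + 1) = lam * p / mu * b / N - T := by
    field_simp
    linear_combination -hcut
  rw [hfk] at hlast
  have hmain : a * (1 + nu k * (lam * p / nu (k + 1)) / mu / N)
      - lam * p / nu (k + 1) * b * (1 + lam / mu / N)
      = (-(V - nu k * (lam * p / mu) * a / N) - lam * T) / nu (k + 1) := by
    field_simp
    field_simp at hlast
    linear_combination hlast
  rw [hmain, abs_div, abs_of_pos hnu, div_le_iff₀ hnu]
  have hfin : (C₁ + lam * C₂) / nu (k + 1) * a / N ^ 2 * nu (k + 1)
      = C₁ * a / N ^ 2 + lam * (C₂ * a / N ^ 2) := by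
    field_simp
  rw [hfin]
  obtain ⟨v1, v2⟩ := abs_le.mp hV
  have t1 := mul_le_mul_of_nonneg_left hTb hlam.le
  have t0 := mul_nonneg hlam.le hT0
  rw [abs_le]
  constructor <;> linarith

end IsCutBalanced

/-! ### From balance inequalities to cut equations. -/

/-- Excess of the flow out of the states with at most `m` customers in the system and `n` in the
orbit over the flow into this set. -/
def levelExcess (lam mu : ℝ) (nu : ℕ → ℝ) (f : ℕ → ℕ → ℝ) (m n : ℕ) : ℝ :=
  n * mu * ∑ i ∈ Finset.range (m + 1), f i n + lam * f m n
    - (nu (m + 1) * f (m + 1) n + (n + 1) * mu * ∑ i ∈ Finset.range m, f i (n + 1))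

/-- A nonnegative solution of the balance inequalities whose mass of blocked states tends to zero
satisfies all cut equations. -/
theorem IsCutBalanced.of_subinvariant {k : ℕ} {lam mu p : ℝ} {nu : ℕ → ℝ} {f : ℕ → ℕ → ℝ}
    (lam_pos : 0 < lam) (mu_pos : 0 < mu) (p_pos : 0 < p) (nu_zero : nu 0 = 0)
    (nu_nonneg : ∀ i ≤ k + 1, 0 ≤ nu i) (nu_last_pos : 0 < nu (k + 1))
    (nonneg : ∀ i n, 0 ≤ f i n) (hlim : Tendsto (fun n => f (k + 1) n) atTop (𝓝 0))
    (h_empty : ∀ n : ℕ, nu 1 * f 1 n ≤ (lam + n * mu) * f 0 n)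
    (h_mid : ∀ i < k, ∀ n : ℕ, lam * f i n + nu (i + 2) * f (i + 2) n + (n + 1) * mu * f i (n + 1)
      ≤ (lam + n * mu + nu (i + 1)) * f (i + 1) n)
    (h_last_zero : lam * f k 0 + mu * f k 1 ≤ (lam * p + nu (k + 1)) * f (k + 1) 0)
    (h_last : ∀ n : ℕ, lam * f k (n + 1) + (n + 2) * mu * f k (n + 2) + lam * p * f (k + 1) n
      ≤ (lam * p + nu (k + 1)) * f (k + 1) (n + 1)) :
    IsCutBalanced k lam mu p nu f := by
  set G := levelExcess lam mu nu f with hG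
  -- `A n` is the excess outflow of `{orbit ≤ n}`. Each hypothesis says that adding one state to a
  -- set does not decrease the excess. Hence `G` grows with `m` and `A` grows with `n`, from
  -- nonnegative values; as `A n` is at most `lam * p * f (k + 1) n → 0`, everything vanishes.
  set A : ℕ → ℝ := fun n => lam * p * f (k + 1) n
    - (n + 1) * mu * ∑ i ∈ Finset.range (k + 1), f i (n + 1) with hA
  have G_zero : ∀ n, 0 ≤ G 0 n := fun n => by
    have := h_empty n
    simp only [hG, levelExcess, zero_add, Finset.sum_range_one, Finset.sum_range_zero]
    linarith
  have G_step : ∀ m < k, ∀ n, G m n ≤ G (m + 1) n := fun m hm n => by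
    have := h_mid m hm n
    simp only [hG, levelExcess]
    rw [Finset.sum_range_succ (fun i => f i n) (m + 1),
      Finset.sum_range_succ (fun i => f i (n + 1)) m]
    linarith
  have G_mono : ∀ l ≤ k, ∀ m ≤ l, ∀ n, G m n ≤ G l n := by
    intro l hl m hm n
    induction l, hm using Nat.le_induction with
    | base => exact le_rfl
    | succ l hml ih => exact (ih (by omega)).trans (G_step l (by omega) n)
  have G_nonneg : ∀ m ≤ k, ∀ n, 0 ≤ G m n := fun m hm n =>
    (G_zero n).trans (G_mono m hm 0 (Nat.zero_le _) n)
  have A_zero : G k 0 ≤ A 0 := by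
    simp only [hG, levelExcess, hA]
    rw [Finset.sum_range_succ (fun i => f i (0 + 1)) k]
    push_cast
    simp only [zero_add]
    linarith
  have A_succ : ∀ n, A n + G k (n + 1) ≤ A (n + 1) := fun n => by
    have := h_last n
    simp only [hG, levelExcess, hA]
    rw [Finset.sum_range_succ (fun i => f i (n + 1 + 1)) k]
    push_cast
    have e : (n : ℝ) + 1 + 1 = n + 2 := by ring
    rw [e]
    linarith
  have A_mono : Monotone A := monotone_nat_of_le_succ fun n => by
    have := A_succ n
    have := G_nonneg k le_rfl (n + 1)
    linarith
  have A_nonneg : ∀ n, 0 ≤ A n := fun n =>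
    ((G_nonneg k le_rfl 0).trans A_zero).trans (A_mono (Nat.zero_le n))
  have A_nonpos : ∀ n, A n ≤ 0 := fun n => by
    have h1 : Tendsto (fun N => lam * p * f (k + 1) N) atTop (𝓝 0) := by
      simpa using hlim.const_mul (lam * p)
    refine ge_of_tendsto h1 ?_
    filter_upwards [eventually_ge_atTop n] with N hN
    refine (A_mono hN).trans (sub_le_self _ (mul_nonneg (by positivity) ?_))
    exact Finset.sum_nonneg fun i _ => nonneg _ _
  have A_eq : ∀ n, A n = 0 := fun n => le_antisymm (A_nonpos n) (A_nonneg n)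
  have G_last : ∀ n, G k n ≤ 0 := by
    intro n
    rcases n with _ | n
    · exact A_zero.trans (A_nonpos 0)
    · have := A_succ n
      rw [A_eq, A_eq] at this
      linarith
  exact {
    lam_pos, mu_pos, p_pos, nu_zero, nu_nonneg, nu_last_pos, nonneg
    cut_orbit := fun n => sub_eq_zero.mp (A_eq n)
    cut_level := fun m hm n => sub_eq_zero.mp
      (le_antisymm ((G_mono k le_rfl m hm n).trans (G_last n)) (G_nonneg m hm n)) }

/-! ### Subinvariance of limiting probabilities. -/

theorem HasLimitingDistribution.nonneg {Ω S : Type*} [MeasurableSpace Ω] {P : Measure Ω}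
    {X : ℝ≥0 → Ω → S} {π : S → ℝ} (hπ : HasLimitingDistribution P X π) (x : S) : 0 ≤ π x :=
  ge_of_tendsto' (hπ.1 x) fun _ => measureReal_nonneg

section Limit

variable {Ω S : Type*} [MeasurableSpace Ω] [MeasurableSpace S] [MeasurableSingletonClass S]
  [DecidableEq S] {P : Measure Ω} [IsProbabilityMeasure P] {X : ℝ≥0 → Ω → S} {Q : S → S → ℝ}
  {π : S → ℝ}

/-- Limiting probabilities are subinvariant for the generator, on every finite set. -/
theorem HasLimitingDistribution.sum_mul_generator_nonpos (hπ : HasLimitingDistribution P X π)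
    (hX : IsMarkovChainWithGenerator P X Q) (F : Finset S) {y : S} (hy : y ∈ F) :
    ∑ x ∈ F, π x * Q x y ≤ 0 := by
  obtain ⟨hmeas, p, hp, hM⟩ := hX
  have hms : ∀ t x, MeasurableSet {ω | X t ω = x} := fun t x =>
    hmeas t (measurableSet_singleton x)
  have hfin : ∀ s t, ∑ x ∈ F, P.real {ω | X s ω = x} * p t x y ≤ P.real {ω | X (s + t) ω = y} := by
    intro s t
    have h1 : ∀ x ∈ F, P.real {ω | X s ω = x} * p t x y =
        P.real ({ω | X s ω = x} ∩ {ω | X (s + t) ω = y}) := fun x _ => by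
      have := hM s t x y Set.univ MeasurableSet.univ
      rw [Set.univ_inter] at this
      exact this.symm
    rw [Finset.sum_congr rfl h1, ← measureReal_biUnion_finset]
    · refine measureReal_mono ?_
      exact Set.iUnion₂_subset fun x _ => Set.inter_subset_right
    · intro x _ x' _ hxx'
      refine Set.disjoint_left.mpr fun ω hω hω' => hxx' ?_
      exact hω.1.symm.trans hω'.1
    · exact fun x _ => (hms s x).inter (hms (s + t) y)
  -- Let `s → ∞` with `t` fixed; `F` being finite, the limit passes through the sum.
  have hsub : ∀ t, ∑ x ∈ F, π x * p t x y ≤ π y := by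
    intro t
    have hl : Tendsto (fun s => ∑ x ∈ F, P.real {ω | X s ω = x} * p t x y) atTop
        (𝓝 (∑ x ∈ F, π x * p t x y)) :=
      tendsto_finsetSum F fun x _ => (hπ.1 x).mul_const _
    have hr : Tendsto (fun s => P.real {ω | X (s + t) ω = y}) atTop (𝓝 (π y)) :=
      (hπ.1 y).comp (tendsto_atTop_mono (fun _ => le_self_add) tendsto_id)
    exact le_of_tendsto_of_tendsto' hl hr fun s => hfin s t
  have hlim : Tendsto (fun t : ℝ≥0 => ∑ x ∈ F, π x * ((p t x y - p 0 x y) / (t : ℝ))) (𝓝[>] 0)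
      (𝓝 (∑ x ∈ F, π x * Q x y)) :=
    tendsto_finsetSum F fun x _ => (hp.deriv_zero x y).const_mul _
  refine le_of_tendsto' hlim fun t => ?_
  -- Equality at `t = 0`, where `y ∈ F` is needed, makes every difference quotient nonpositive.
  have h0 : ∑ x ∈ F, π x * p 0 x y = π y := by
    simp_rw [hp.zero]
    simp [hy]
  have h1 : ∑ x ∈ F, π x * ((p t x y - p 0 x y) / (t : ℝ)) =
      (∑ x ∈ F, π x * p t x y - ∑ x ∈ F, π x * p 0 x y) / t := by
    rw [← Finset.sum_sub_distrib, Finset.sum_div]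
    exact Finset.sum_congr rfl fun x _ => by ring
  rw [h1, h0]
  exact div_nonpos_of_nonpos_of_nonneg (sub_nonpos.mpr (hsub t)) t.2

end Limit

/-! ### Balance inequalities of the retrial queue. -/

namespace RetrialQueue

theorem nu_nonneg {K : ℕ} (M : RetrialQueue K) (i : ℕ) (hi : i ≤ K) : 0 ≤ M.nu i := by
  induction i with
  | zero => exact M.nu_zero.ge
  | succ i ih => exact (ih (by omega)).trans (M.nu_mono i (by omega))

/-- The mass function of a distribution on the states, with natural number indices. -/
def mass {K : ℕ} (π : State K → ℝ) (i n : ℕ) : ℝ := π (Fin.ofNat (K + 1) i, n)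

theorem mass_apply {K : ℕ} (π : State K → ℝ) (i : Fin (K + 1)) (n : ℕ) :
    mass π i n = π (i, n) := by
  simp [mass]

theorem mass_mk {K : ℕ} (π : State K → ℝ) {i : ℕ} (hi : i < K + 1) (n : ℕ) :
    mass π i n = π (⟨i, hi⟩, n) :=
  mass_apply π ⟨i, hi⟩ n

/-- Subinvariance is applied on finite sets consisting of a target state and all states that jump
into it, so no inflow is lost. -/
theorem isCutBalanced_mass {k : ℕ} (M : RetrialQueue (k + 1)) (hq : M.q = 1) (hr : M.r = 1)
    (hp : 0 < M.p) (hν : 0 < M.nu (k + 1)) {Ω : Type*} [MeasurableSpace Ω] (P : Measure Ω)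
    [IsProbabilityMeasure P] (X : ℝ≥0 → Ω → State (k + 1))
    (hX : IsMarkovChainWithGenerator P X M.generator) (π : State (k + 1) → ℝ)
    (hπ : HasLimitingDistribution P X π) :
    IsCutBalanced k M.lam M.mu M.p M.nu (mass π) := by
  have hsub : ∀ (F : Finset (State (k + 1))) (y : State (k + 1)), y ∈ F →
      ∑ x ∈ F, π x * M.generator x y ≤ 0 :=
    fun F y hy => hπ.sum_mul_generator_nonpos hX F hy
  refine IsCutBalanced.of_subinvariant M.lam_pos M.mu_pos hp M.nu_zero M.nu_nonneg hν
    (fun i n => hπ.nonneg _) ?_ ?_ ?_ ?_ ?_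
  · have hinj : Function.Injective fun n : ℕ => ((Fin.ofNat (k + 1 + 1) (k + 1), n) : State (k + 1)) :=
      fun a b hab => (Prod.ext_iff.mp hab).2
    exact (hπ.2.summable.comp_injective hinj).tendsto_atTop_zero
  · intro n
    have h := hsub {(⟨0, by omega⟩, n), (⟨1, by omega⟩, n)} (⟨0, by omega⟩, n) (by simp)
    rw [Finset.sum_insert (by simp), Finset.sum_singleton] at h
    have m0 : mass π 0 n = π (0, n) := mass_apply π 0 n
    have m1 : mass π 1 n = π (1, n) := mass_apply π 1 n
    rw [m0, m1]
    simp [generator, blockLocal, diag, Fin.ext_iff, M.nu_zero] at h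
    linarith
  · intro i hi n
    have h := hsub {(⟨i + 1, by omega⟩, n), (⟨i, by omega⟩, n), (⟨i + 2, by omega⟩, n),
      (⟨i, by omega⟩, n + 1)} (⟨i + 1, by omega⟩, n) (by simp)
    rw [Finset.sum_insert (by simp), Finset.sum_insert (by simp), Finset.sum_insert (by simp),
      Finset.sum_singleton] at h
    rw [mass_mk π (show i < k + 1 + 1 by omega), mass_mk π (show i < k + 1 + 1 by omega),
      mass_mk π (show i + 1 < k + 1 + 1 by omega), mass_mk π (show i + 2 < k + 1 + 1 by omega)]
    have e1 : i ≠ k := by omega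
    have e2 : i ≠ k + 1 := by omega
    have e3 : n ≠ n + 1 + 1 := by omega
    simp [generator, blockLocal, blockDown, diag, Fin.ext_iff, hr, e1, e2, e3] at h
    linarith
  · have h := hsub {(⟨k + 1, by omega⟩, 0), (⟨k, by omega⟩, 0), (⟨k, by omega⟩, 1)}
      (⟨k + 1, by omega⟩, 0) (by simp)
    rw [Finset.sum_insert (by simp), Finset.sum_insert (by simp), Finset.sum_singleton] at h
    rw [mass_mk π (show k < k + 1 + 1 by omega), mass_mk π (show k < k + 1 + 1 by omega),
      mass_mk π (show k + 1 < k + 1 + 1 by omega)]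
    simp [generator, blockLocal, blockDown, diag, Fin.ext_iff, hr] at h
    linarith
  · intro n
    have h := hsub {(⟨k + 1, by omega⟩, n + 1), (⟨k, by omega⟩, n + 1), (⟨k, by omega⟩, n + 2),
      (⟨k + 1, by omega⟩, n)} (⟨k + 1, by omega⟩, n + 1) (by simp)
    rw [Finset.sum_insert (by simp), Finset.sum_insert (by simp), Finset.sum_insert (by simp),
      Finset.sum_singleton] at h
    rw [mass_mk π (show k < k + 1 + 1 by omega), mass_mk π (show k < k + 1 + 1 by omega),
      mass_mk π (show k + 1 < k + 1 + 1 by omega), mass_mk π (show k + 1 < k + 1 + 1 by omega)]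
    simp [generator, blockUp, blockLocal, blockDown, diag, Fin.ext_iff, hr, hq] at h
    linarith

theorem exists_mass_ne_zero {K : ℕ} {π : State K → ℝ} (hπ : HasSum π 1) :
    ∃ i ≤ K, ∃ n, mass π i n ≠ 0 := by
  by_contra! h
  have hz : π = fun _ => 0 := by
    funext ⟨i, n⟩
    rw [← mass_apply π]
    exact h i (Nat.lt_succ_iff.mp i.2) n
  rw [hz] at hπ
  exact zero_ne_one (hasSum_zero.unique hπ)

end RetrialQueue

theorem mainTheorem5 {K : ℕ} (hK : 1 ≤ K) (M : RetrialQueue K)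
    (hq : M.q = 1) (hr : M.r = 1) (hp : 0 < M.p) (hν : 0 < M.nu K)
    {Ω : Type*} [MeasurableSpace Ω] (P : Measure Ω) [IsProbabilityMeasure P]
    (X : ℝ≥0 → Ω → RetrialQueue.State K)
    (hX : IsMarkovChainWithGenerator P X M.generator)
    (π : RetrialQueue.State K → ℝ) (hπ : HasLimitingDistribution P X π) :
    ∃ D₁ D₂ : ℝ, 0 < D₁ ∧ 0 < D₂ ∧ ∀ n : ℕ, 1 ≤ n →
      D₁ * (n : ℝ) ^ M.alpha * M.rho ^ n ≤ π (Fin.last K, n) ∧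
        π (Fin.last K, n) ≤ D₂ * (n : ℝ) ^ M.alpha * M.rho ^ n := by
  obtain ⟨k, rfl⟩ := Nat.exists_eq_add_of_le' hK
  have h := M.isCutBalanced_mass hq hr hp hν P X hX π hπ
  have hpos := h.last_pos (RetrialQueue.exists_mass_ne_zero hπ.2)
  obtain ⟨E, hE, hratio⟩ := h.exists_ratio_bound
  have hmu := M.mu_pos
  have hlam := M.lam_pos
  -- This is `α = d - c`.
  have halpha : M.alpha =
      M.lam / M.mu - M.nu k * (M.lam * M.p / M.nu (k + 1)) / M.mu := by
    simp only [RetrialQueue.alpha, RetrialQueue.rho, Nat.add_sub_cancel]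
    field_simp
  obtain ⟨D₁, D₂, h1, h2, hb⟩ :=
    exists_rpow_mul_pow_bounds hpos (show 0 < M.lam * M.p / M.nu (k + 1) by positivity) hE hratio
  refine ⟨D₁, D₂, h1, h2, fun n hn => ?_⟩
  rw [halpha, ← RetrialQueue.mass_apply π, Fin.val_last]
  exact hb n hn
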